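/- Let $G=(V,E,w)$ be a finite weighted hypergraph: $V$ is a finite set, $E$ is a family of subsets of $V$ each having at least two elements, and $w:E\to(0,\infty)$. Let $1\le p<3$ and, on $\mathbb R^V$ with its Euclidean inner product, put $$\varphi(x)=\frac1p\sum_{e\in E}w(e)\Big(\max_{u,v\in e}(x(u)-x(v))\Big)^p .$$ Fix a subset $D\subset V$ of controlled vertices. For $b\in\mathbb R^V$ let $K_b=\{x\in\mathbb R^V:\ x(v)=b(v)\ \text{for all } v\in D\}$, let $I_{K_b}$ be its indicator function ($0$ on $K_b$, $+\infty$ elsewhere), and let $\partial\psi(x)=\{\eta:\ \eta\cdot(z-x)\le\psi(z)-\psi(x)\ \forall z\in\mathbb R^V\}$ denote the subdifferential of $\psi$ at a point $x$ with $\psi(x)<\infty$, and $\partial\psi(x)=\varnothing$ if $\psi(x)=+\infty$. Let $a,h:[0,\infty)\to\mathbb R^V$ with $a(t)(v)=0$ for $v\notin D$, $a\in W^{1,2}(0,T;\mathbb R^V)$ and $h\in L^2(0,T;\mathbb R^V)$ for every $T>0$, and $a',h'\in L^1(0,\infty;\mathbb R^V)$ ($a$ and $h$ being identified with their continuous representatives),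 so that the limits $a_\infty=\lim_{t\to\infty}a(t)$ and $h_\infty=\lim_{t\to\infty}h(t)$ exist. Suppose moreover that $$a'\in L^2(0,\infty;\mathbb R^V),\quad a-a_\infty\in L^1(0,\infty;\mathbb R^V),\quad h-h_\infty\in L^1(0,\infty;\mathbb R^V)\cap L^2(0,\infty;\mathbb R^V),$$ and that $h_\infty$ belongs to the range $R(\partial\varphi+\partial I_{K_{a_\infty}})$, i.e. $h_\infty\in\partial\varphi(z)+\partial I_{K_{a_\infty}}(z)$ for some $z\in\mathbb R^V$. Let $x_0\in K_{a(0)}$ and let $x:[0,\infty)\to\mathbb R^V$, with $x\in W^{1,2}(0,T;\mathbb R^V)$ for every $T>0$, be the solution of $$x'(t)+\partial\varphi(x(t))+\partial I_{K_{a(t)}}(x(t))\ni h(t)\quad\text{for a.e. } t>0,\qquad x(0)=x_0 .$$ Then $x(t)$ converges as $t\to\infty$ to a (uniquely determined) limit $x_\infty\in\mathbb R^V$, and $\partial\varphi(x_\infty)+\partial I_{K_{a_\infty}}(x_\infty)\ni h_\infty$. -/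

import Mathlib

open MeasureTheory Set Filter Topology
open scoped Pointwise

noncomputable section

/-- A finite weighted hypergraph `G = (V, E, w)`: a finite family `E` of subsets of `V`, each with
at least two elements, and a positive weight for every hyperedge (the values of `weight` outside
`edges` play no role). -/
structure WeightedHypergraph (V : Type*) where
  edges : Finset (Finset V)
  two_le_card : ∀ e ∈ edges, 2 ≤ e.card
  weight : Finset V → ℝ
  weight_pos : ∀ e ∈ edges, 0 < weight e

/-- `f_e(x) = max_{u, v ∈ e} (x(u) - x(v))`. -/
def edgeSpread {V : Type*} (e : Finset V) (x : EuclideanSpace ℝ V) : ℝ :=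
  ⨆ q : e × e, (x q.1 - x q.2)

/-- The energy `φ_{G,p}(x) = (1/p) ∑_{e ∈ E} w(e) f_e(x)^p`. -/
def WeightedHypergraph.energy {V : Type*} (G : WeightedHypergraph V) (p : ℝ)
    (x : EuclideanSpace ℝ V) : ℝ :=
  (1 / p) * ∑ e ∈ G.edges, G.weight e * edgeSpread e x ^ p

/-- The subdifferential at `x` of an extended-real-valued function `ψ` which never takes the
value `-∞`. It is empty at points with `ψ x = +∞`, because `⊤ - ⊤ = ⊥` in `EReal` (take `z = x`). -/
def subdifferential {H : Type*} [NormedAddCommGroup H] [InnerProductSpace ℝ H]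
    (ψ : H → EReal) (x : H) : Set H :=
  {η | ∀ z : H, ((inner ℝ η (z - x) : ℝ) : EReal) ≤ ψ z - ψ x}

/-- The indicator function (in the sense of convex analysis) of a set. -/
def convexIndicator {H : Type*} (K : Set H) (x : H) : EReal :=
  open Classical in if x ∈ K then 0 else ⊤

/-- `K_b`: the vectors whose components on the controlled vertices `D` are those of `b`. -/
def constraintSet {V : Type*} (D : Set V) (b : EuclideanSpace ℝ V) :
    Set (EuclideanSpace ℝ V) :=
  {x | ∀ v ∈ D, x v = b v}

/-- The multivalued operator `x ↦ ∂φ_{G,p}(x) + ∂I_{K_b}(x)` (Minkowski sum of sets). -/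
def WeightedHypergraph.constrainedLaplacian {V : Type*} [Fintype V] (G : WeightedHypergraph V)
    (p : ℝ) (D : Set V) (b x : EuclideanSpace ℝ V) : Set (EuclideanSpace ℝ V) :=
  subdifferential (fun z => ((G.energy p z : ℝ) : EReal)) x +
    subdifferential (convexIndicator (constraintSet D b)) x

/-- `g` is absolutely continuous on every interval `[0, T]`; then its almost everywhere derivative
`deriv g` is its weak derivative on `(0, ∞)`. -/
def LocallyAC {H : Type*} [NormedAddCommGroup H] (g : ℝ → H) : Prop :=
  ∀ T : ℝ, 0 < T → AbsolutelyContinuousOnInterval g 0 T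

/-- `g ∈ L^2(0, T; H)` for every `T > 0`. -/
def MemL2Loc {H : Type*} [NormedAddCommGroup H] (g : ℝ → H) : Prop :=
  ∀ T : ℝ, 0 < T → MemLp g 2 (volume.restrict (Ioo 0 T))

/-- `g` is the continuous representative of an element of `W^{1,2}(0, T; H)` for every `T > 0`. -/
structure MemW12Loc {H : Type*} [NormedAddCommGroup H] [NormedSpace ℝ H] (g : ℝ → H) : Prop where
  locallyAC : LocallyAC g
  memL2Loc : MemL2Loc g
  memL2Loc_deriv : MemL2Loc (deriv g)

/-- `x` is a global solution on `[0, ∞)` of the Cauchy problem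
`x'(t) + ∂φ_{G,p}(x(t)) + ∂I_{K_{a(t)}}(x(t)) ∋ h(t)`, `x(0) = x₀`. -/
structure WeightedHypergraph.IsGlobalSolution {V : Type*} [Fintype V] (G : WeightedHypergraph V)
    (p : ℝ) (D : Set V) (a h : ℝ → EuclideanSpace ℝ V) (x₀ : EuclideanSpace ℝ V)
    (x : ℝ → EuclideanSpace ℝ V) : Prop where
  memW12Loc : MemW12Loc x
  inclusion : ∀ᵐ t ∂(volume.restrict (Ioi (0 : ℝ))),
    h t ∈ {deriv x t} + G.constrainedLaplacian p D (a t) (x t)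
  initial : x 0 = x₀

end

/-! ### Subgradients of the energy and of the indicator. -/

section Subdifferential

variable {H : Type*} [NormedAddCommGroup H] [InnerProductSpace ℝ H]

/-! Let `z` be an equilibrium and test the inclusion with `d = x - z - (a - a_inf)`. It vanishes on
`D`, so the constraint term drops out, and it equals `x - z` on the free vertices. The squared free
distance to `z` therefore has derivative at most `2 (‖h - h_inf‖ ‖d‖ + ‖a - a_inf‖ ‖η‖)` minus twice
the excess of the tilted energy, where `η` is a subgradient at `x` (`inner_velocity_le`). The excess
is bounded below by a multiple of `-‖a - a_inf‖`. Since `p ≤ 3`, `‖η‖` is at most quadratic in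
`‖x‖`, so a Grönwall argument bounds `x`, and the error terms become integrable. The excess then
cannot stay above a positive constant. A sequence of times along which its upper limit is at most
zero has a cluster point `y` of `x`, which is an equilibrium by `mem_constrainedLaplacian_of_le`.
Centred at `y`, the free distance has a limit; it is zero along the subsequence, hence zero. -/

theorem mem_subdifferential_coe_iff {f : H → ℝ} {x η : H} :
    η ∈ subdifferential (fun z => ((f z : ℝ) : EReal)) x ↔
      ∀ z, inner ℝ η (z - x) ≤ f z - f x := by
  simp only [subdifferential, mem_ofPred_eq]
  refine forall_congr' fun z => ?_
  rw [← EReal.coe_sub, EReal.coe_le_coe_iff]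

variable {V : Type*} [Fintype V] {D : Set V}

/-- `K_b` is a translate of the linear space of vectors vanishing on `D`, so its normal cone at each
of its points is the orthogonal complement of that space. -/
theorem mem_subdifferential_indicator_iff {b x ν : EuclideanSpace ℝ V} :
    ν ∈ subdifferential (convexIndicator (constraintSet D b)) x ↔
      x ∈ constraintSet D b ∧ ∀ d ∈ constraintSet D (0 : EuclideanSpace ℝ V), inner ℝ ν d = 0 := by
  constructor
  · intro hν
    have hx : x ∈ constraintSet D b := by
      by_contra hx
      have := hν x
      simp [convexIndicator, hx] at this
    refine ⟨hx, fun d hd => ?_⟩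
    have key : ∀ d ∈ constraintSet D (0 : EuclideanSpace ℝ V), inner ℝ ν d ≤ 0 := by
      intro d hd
      have hz : x + d ∈ constraintSet D b := fun v hv => by
        have h1 := hx v hv
        have h2 := hd v hv
        simp_all
      have := hν (x + d)
      simpa [convexIndicator, hx, hz] using this
    have h1 := key d hd
    have h2 := key (-d) (fun v hv => by simpa using hd v hv)
    rw [inner_neg_right] at h2
    linarith
  · rintro ⟨hx, hν⟩ z
    by_cases hz : z ∈ constraintSet D b
    · have := hν (z - x) (fun v hv => by
        have h1 := hx v hv
        have h2 := hz v hv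
        simp_all)
      simp [convexIndicator, hx, hz, this]
    · simp [convexIndicator, hx, hz]

/-- The inclusion `g ∈ ∂φ(x) + ∂I_{K_b}(x)` in terms of a subgradient `η` of the energy: the
difference `g - η` is orthogonal to the vectors vanishing on `D`. -/
theorem WeightedHypergraph.mem_constrainedLaplacian_iff {G : WeightedHypergraph V} {p : ℝ}
    {b x g : EuclideanSpace ℝ V} :
    g ∈ G.constrainedLaplacian p D b x ↔
      x ∈ constraintSet D b ∧ ∃ η : EuclideanSpace ℝ V,
        (∀ z, inner ℝ η (z - x) ≤ G.energy p z - G.energy p x) ∧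
        ∀ d ∈ constraintSet D (0 : EuclideanSpace ℝ V), inner ℝ η d = inner ℝ g d := by
  rw [WeightedHypergraph.constrainedLaplacian, Set.mem_add]
  constructor
  · rintro ⟨η, hη, ν, hν, rfl⟩
    rw [mem_subdifferential_coe_iff] at hη
    rw [mem_subdifferential_indicator_iff] at hν
    exact ⟨hν.1, η, hη, fun d hd => by rw [inner_add_left, hν.2 d hd, add_zero]⟩
  · rintro ⟨hx, η, hη, h⟩
    refine ⟨η, mem_subdifferential_coe_iff.2 hη, g - η,
      mem_subdifferential_indicator_iff.2 ⟨hx, fun d hd => ?_⟩, by abel⟩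
    rw [inner_sub_left, h d hd, sub_self]

end Subdifferential

/-! ### Growth of the energy, dissipation, and equilibria. -/

section Energy

variable {V : Type*}

theorem edgeSpread_zero (e : Finset V) : edgeSpread e (0 : EuclideanSpace ℝ V) = 0 := by
  simp [edgeSpread]

theorem edgeSpread_nonneg (e : Finset V) (x : EuclideanSpace ℝ V) : 0 ≤ edgeSpread e x := by
  -- For empty `e` the real supremum takes its default value `0`.
  rcases e.eq_empty_or_nonempty with rfl | ⟨v, hv⟩
  · simp [edgeSpread]
  · exact Real.iSup_nonneg' ⟨(⟨v, hv⟩, ⟨v, hv⟩), by simp⟩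

theorem WeightedHypergraph.energy_nonneg (G : WeightedHypergraph V) {p : ℝ} (hp : 1 ≤ p)
    (x : EuclideanSpace ℝ V) : 0 ≤ G.energy p x := by
  refine mul_nonneg (by positivity)
    (Finset.sum_nonneg fun e he => mul_nonneg (G.weight_pos e he).le ?_)
  exact Real.rpow_nonneg (edgeSpread_nonneg e x) p

variable [Fintype V]

theorem edgeSpread_le_add (e : Finset V) (x y : EuclideanSpace ℝ V) :
    edgeSpread e x ≤ edgeSpread e y + 2 * ‖x - y‖ := by
  rcases isEmpty_or_nonempty (e × e) with he | he
  · simp [edgeSpread]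
  · refine ciSup_le fun q => ?_
    have h1 : y q.1 - y q.2 ≤ edgeSpread e y :=
      le_ciSup (f := fun q : e × e => y q.1 - y q.2) (Set.finite_range _).bddAbove q
    have h2 := PiLp.norm_apply_le (x - y) (q.1 : V)
    have h3 := PiLp.norm_apply_le (x - y) (q.2 : V)
    simp only [PiLp.sub_apply, Real.norm_eq_abs, abs_le] at h2 h3
    linarith [h2.2, h3.1]

theorem edgeSpread_le (e : Finset V) (x : EuclideanSpace ℝ V) : edgeSpread e x ≤ 2 * ‖x‖ := by
  simpa [edgeSpread_zero] using edgeSpread_le_add e x 0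

theorem continuous_edgeSpread (e : Finset V) :
    Continuous (edgeSpread e : EuclideanSpace ℝ V → ℝ) := by
  refine (LipschitzWith.of_dist_le_mul (K := 2) fun x y => ?_).continuous
  rw [Real.dist_eq, abs_le, dist_eq_norm]
  have h1 := edgeSpread_le_add e x y
  have h2 := edgeSpread_le_add e y x
  rw [norm_sub_rev] at h2
  push_cast
  constructor <;> linarith

namespace WeightedHypergraph

variable (G : WeightedHypergraph V) {p : ℝ}

theorem continuous_energy (hp : 1 ≤ p) : Continuous (G.energy p) := by
  unfold energy
  refine continuous_const.mul (continuous_finsetSum _ fun e _ => continuous_const.mul ?_)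
  exact (continuous_edgeSpread e).rpow_const fun _ => Or.inr (by linarith)

theorem exists_energy_le (hp : 1 ≤ p) :
    ∃ C, 0 ≤ C ∧ ∀ (x : EuclideanSpace ℝ V) (R : ℝ), ‖x‖ ≤ R → G.energy p x ≤ C * R ^ p := by
  refine ⟨(1 / p) * ∑ e ∈ G.edges, G.weight e * 2 ^ p, ?_, fun x R hR => ?_⟩
  · exact mul_nonneg (by positivity)
      (Finset.sum_nonneg fun e he => mul_nonneg (G.weight_pos e he).le (by positivity))
  · have hR0 : 0 ≤ R := (norm_nonneg x).trans hR
    rw [energy, mul_assoc, Finset.sum_mul]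
    refine mul_le_mul_of_nonneg_left (Finset.sum_le_sum fun e he => ?_) (by positivity)
    rw [mul_assoc, ← Real.mul_rpow (by norm_num) hR0]
    refine mul_le_mul_of_nonneg_left ?_ (G.weight_pos e he).le
    exact Real.rpow_le_rpow (edgeSpread_nonneg e x)
      ((edgeSpread_le e x).trans (by linarith)) (by linarith)

/-- Subgradients of the energy grow like `‖x‖ ^ (p - 1)`, hence at most quadratically when
`p ≤ 3`. -/
theorem exists_subgradient_norm_le (hp : 1 ≤ p) (hp3 : p ≤ 3) :
    ∃ C, 0 ≤ C ∧ ∀ x η : EuclideanSpace ℝ V,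
      (∀ z, inner ℝ η (z - x) ≤ G.energy p z - G.energy p x) → ‖η‖ ≤ C * (1 + ‖x‖) ^ 2 := by
  obtain ⟨C, hC, hbound⟩ := G.exists_energy_le hp
  refine ⟨C * 2 ^ p, by positivity, fun x η hη => ?_⟩
  rcases eq_or_ne η 0 with rfl | hne
  · simp only [norm_zero]; positivity
  have hpos : 0 < ‖η‖ := norm_pos_iff.2 hne
  -- Testing at distance `R` from `x` in the direction of `η` gives `R ‖η‖ ≤ C (2R)^p`; as `R ≥ 1`,
  -- `R^p ≤ R^3`, and one factor `R` cancels.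
  set R := 1 + ‖x‖ with hR
  have hR1 : 1 ≤ R := by have := norm_nonneg x; linarith
  have h1 := hη (x + (R / ‖η‖) • η)
  rw [add_sub_cancel_left, inner_smul_right, real_inner_self_eq_norm_sq] at h1
  have h2 : R / ‖η‖ * ‖η‖ ^ 2 = R * ‖η‖ := by field_simp
  have h3 : ‖x + (R / ‖η‖) • η‖ ≤ 2 * R := by
    refine (norm_add_le _ _).trans ?_
    rw [norm_smul, Real.norm_of_nonneg (by positivity), div_mul_cancel₀ _ hpos.ne']
    linarith
  have h4 := hbound _ _ h3
  have h5 := G.energy_nonneg hp x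
  have h6 : (2 * R) ^ p ≤ 2 ^ p * (R * R ^ 2) := by
    rw [Real.mul_rpow (by norm_num) (by linarith)]
    refine mul_le_mul_of_nonneg_left ?_ (by positivity)
    calc R ^ p ≤ R ^ (3 : ℝ) := Real.rpow_le_rpow_of_exponent_le hR1 hp3
      _ = R * R ^ 2 := by norm_cast; ring
  have h7 : R * ‖η‖ ≤ R * (C * 2 ^ p * R ^ 2) := by
    have := mul_le_mul_of_nonneg_left h6 hC
    nlinarith
  exact le_of_mul_le_mul_left h7 (by linarith)

/-- The pointwise dissipation estimate: comparison of a solution at a fixed time with an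
equilibrium `z`. -/
theorem inner_velocity_le {D : Set V} {a a' h h' x x' z ζ : EuclideanSpace ℝ V}
    (hz : z ∈ constraintSet D a')
    (hζ : ∀ u, inner ℝ ζ (u - z) ≤ G.energy p u - G.energy p z)
    (hζ' : ∀ d ∈ constraintSet D (0 : EuclideanSpace ℝ V), inner ℝ ζ d = inner ℝ h' d)
    (hx : h ∈ {x'} + G.constrainedLaplacian p D a x) :
    ∃ η : EuclideanSpace ℝ V, (∀ u, inner ℝ η (u - x) ≤ G.energy p u - G.energy p x) ∧
      inner ℝ x' (x - z - (a - a')) ≤ ‖h - h'‖ * ‖x - z - (a - a')‖ + ‖a - a'‖ * ‖η‖ -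
        (G.energy p x - G.energy p z - inner ℝ h' (x - z - (a - a'))) ∧
      -(‖ζ‖ * ‖a - a'‖) ≤ G.energy p x - G.energy p z - inner ℝ h' (x - z - (a - a')) := by
  obtain ⟨y, rfl, q, hq, rfl⟩ := Set.mem_add.1 hx
  obtain ⟨hxK, η, hη, hη'⟩ := mem_constrainedLaplacian_iff.1 hq
  -- Subtracting `a - a'` removes the boundary mismatch, so `q` and `η` have the same product with
  -- this vector.
  have hd : x - z - (a - a') ∈ constraintSet D (0 : EuclideanSpace ℝ V) := fun v hv => by
    have h1 := hxK v hv
    have h2 := hz v hv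
    simp_all
  refine ⟨η, hη, ?_, ?_⟩
  · have h1 := hη' _ hd
    have h2 := hη z
    have h3 := real_inner_le_norm (y + q - h') (x - z - (a - a'))
    have h4 := real_inner_le_norm (a - a') η
    rw [real_inner_comm] at h4
    have h5 : inner ℝ η (x - z - (a - a')) = - inner ℝ η (z - x) - inner ℝ η (a - a') := by
      rw [← inner_neg_right, neg_sub, ← inner_sub_right]
    have h6 : inner ℝ (y + q - h') (x - z - (a - a')) = inner ℝ y (x - z - (a - a')) +
        inner ℝ q (x - z - (a - a')) - inner ℝ h' (x - z - (a - a')) := by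
      rw [inner_sub_left, inner_add_left]
    linarith
  · have h1 := hζ' _ hd
    have h2 := hζ x
    have h3 := neg_le_of_abs_le (abs_real_inner_le_norm ζ (a - a'))
    rw [inner_sub_right] at h1
    linarith

/-- Equilibria are characterised by their energy: a point of the constraint set whose tilted energy
does not exceed that of an equilibrium is an equilibrium. -/
theorem mem_constrainedLaplacian_of_le {D : Set V} {b g x z : EuclideanSpace ℝ V}
    (hz : g ∈ G.constrainedLaplacian p D b z) (hx : x ∈ constraintSet D b)
    (hle : G.energy p x - G.energy p z - inner ℝ g (x - z) ≤ 0) :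
    g ∈ G.constrainedLaplacian p D b x := by
  obtain ⟨hzK, ζ, hζ, hζ'⟩ := mem_constrainedLaplacian_iff.1 hz
  -- The subgradient at `z` also serves at `x`: the energy hypothesis says that its affine minorant
  -- is attained there.
  refine mem_constrainedLaplacian_iff.2 ⟨hx, ζ, fun u => ?_, hζ'⟩
  have h1 := hζ' (x - z) (fun v hv => by
    have h1 := hx v hv
    have h2 := hzK v hv
    simp_all)
  have h2 := hζ u
  have h3 : inner ℝ ζ (u - z) = inner ℝ ζ (u - x) + inner ℝ ζ (x - z) := by
    rw [← inner_add_right, sub_add_sub_cancel]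
  linarith

end WeightedHypergraph

end Energy

/-! ### Scalar differential inequalities with integrable coefficients. -/

section DifferentialInequality

variable {F k g : ℝ → ℝ}

theorem AbsolutelyContinuousOnInterval.sub_le_integral {s t : ℝ} (hst : s ≤ t)
    (hF : AbsolutelyContinuousOnInterval F s t) (hg : IntervalIntegrable g volume s t)
    (h : ∀ᵐ r ∂volume.restrict (Ioc s t), deriv F r ≤ g r) :
    F t - F s ≤ ∫ r in s..t, g r := by
  rw [← hF.integral_deriv_eq_sub]
  exact intervalIntegral.integral_mono_ae_restrict hst hF.intervalIntegrable_deriv hg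
    (by rwa [EventuallyLE, ← Measure.restrict_congr_set Ioc_ae_eq_Icc])

theorem LocallyAC.absolutelyContinuousOnInterval {E : Type*} [NormedAddCommGroup E] {f : ℝ → E}
    (hf : LocallyAC f) {s t : ℝ} (hs : 0 ≤ s) (hst : s ≤ t) :
    AbsolutelyContinuousOnInterval f s t :=
  (hf (t + 1) (by linarith)).mono (by
    rw [uIcc_of_le hst, uIcc_of_le (by linarith)]
    exact Icc_subset_Icc hs (by linarith))

theorem LocallyAC.continuousOn {E : Type*} [NormedAddCommGroup E] {f : ℝ → E}
    (hf : LocallyAC f) : ContinuousOn f (Ici 0) := by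
  intro t ht
  have h := (hf (t + 1) (by linarith [mem_Ici.1 ht])).continuousOn t
    (by rw [uIcc_of_le (by linarith [mem_Ici.1 ht])]; exact ⟨ht, by linarith⟩)
  rw [uIcc_of_le (by linarith [mem_Ici.1 ht])] at h
  refine h.mono_of_mem_nhdsWithin ?_
  rw [← Ici_inter_Iic]
  exact inter_mem self_mem_nhdsWithin (mem_nhdsWithin_of_mem_nhds (Iic_mem_nhds (by linarith)))

theorem exists_forall_intervalIntegral_le (hk : IntegrableOn k (Ioi 0)) (hk0 : ∀ t, 0 ≤ k t)
    {ε : ℝ} (hε : 0 < ε) (T : ℝ) : ∃ S, T ≤ S ∧ 0 ≤ S ∧ ∀ t, S ≤ t → ∫ r in S..t, k r ≤ ε := by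
  have h := intervalIntegral_tendsto_integral_Ioi 0 hk tendsto_id
  have h1 : ∀ᶠ s in atTop, (∫ r in Ioi 0, k r) - ε < ∫ r in (0 : ℝ)..s, k r :=
    h.eventually (lt_mem_nhds (by linarith))
  obtain ⟨S, hS, hS'⟩ := (h1.and (eventually_ge_atTop (max T 0))).exists
  refine ⟨S, (le_max_left _ _).trans hS', (le_max_right _ _).trans hS', fun t ht => ?_⟩
  have hS0 : 0 ≤ S := (le_max_right _ _).trans hS'
  have hi : ∀ u v, 0 ≤ u → 0 ≤ v → IntervalIntegrable k volume u v := fun u v hu hv =>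
    intervalIntegrable_iff.2 (hk.mono_set fun r hr => lt_of_le_of_lt (le_min hu hv) hr.1)
  have h2 := intervalIntegral.integral_add_adjacent_intervals (hi 0 S le_rfl hS0)
    (hi S t hS0 (hS0.trans ht))
  have h3 : ∫ r in (0 : ℝ)..t, k r ≤ ∫ r in Ioi 0, k r := by
    rw [intervalIntegral.integral_of_le (hS0.trans ht)]
    exact setIntegral_mono_set hk (ae_of_all _ hk0) Ioc_subset_Ioi_self.eventuallyLE
  linarith

/-- A Grönwall-type bound for an integrable coefficient. -/
theorem LocallyAC.exists_bound_of_deriv_le (hF : LocallyAC F) (hF0 : ∀ t, 0 ≤ F t)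
    (hk : IntegrableOn k (Ioi 0)) (hk0 : ∀ t, 0 ≤ k t) {T : ℝ}
    (h : ∀ᵐ t ∂volume.restrict (Ioi T), deriv F t ≤ k t * (1 + F t)) :
    ∃ S M, T ≤ S ∧ 0 ≤ S ∧ ∀ t, S ≤ t → F t ≤ M := by
  -- With tail integral at most `1/2`, a maximum point `τ` satisfies `F τ - F S ≤ (1 + F τ) / 2`,
  -- whence the bound `2 * F S + 1`.
  obtain ⟨S, hTS, hS0, hS⟩ := exists_forall_intervalIntegral_le hk hk0 (half_pos one_pos) T
  refine ⟨S, 2 * F S + 1, hTS, hS0, fun t ht => ?_⟩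
  obtain ⟨τ, hτ, hmax⟩ := isCompact_Icc.exists_isMaxOn (nonempty_Icc.2 ht)
    (hF.continuousOn.mono (Icc_subset_Ici_self.trans (Ici_subset_Ici.2 hS0)))
  have hki : IntervalIntegrable k volume S τ := intervalIntegrable_iff.2
    (hk.mono_set fun r hr => lt_of_le_of_lt (le_min hS0 (hS0.trans hτ.1)) hr.1)
  have h1 := (hF.absolutelyContinuousOnInterval hS0 hτ.1).sub_le_integral hτ.1
    (hki.mul_const (1 + F τ)) (by
      have h' := ae_restrict_of_ae_restrict_of_subset
        (show Ioc S τ ⊆ Ioi T from fun r hr => lt_of_le_of_lt hTS hr.1) h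
      filter_upwards [h', ae_restrict_mem measurableSet_Ioc] with r hr hrm
      refine hr.trans (mul_le_mul_of_nonneg_left ?_ (hk0 r))
      have : F r ≤ F τ := hmax ⟨hrm.1.le, hrm.2.trans hτ.2⟩
      linarith)
  rw [intervalIntegral.integral_mul_const] at h1
  have h2 := mul_le_mul_of_nonneg_right (hS τ hτ.1) (show 0 ≤ 1 + F τ by linarith [hF0 τ])
  have h3 : F t ≤ F τ := hmax ⟨ht, le_rfl⟩
  linarith

/-- `F` minus the primitive of `g` is nonincreasing and bounded below, and the primitive converges.
-/
theorem LocallyAC.exists_tendsto_of_deriv_le (hF : LocallyAC F) (hF0 : ∀ t, 0 ≤ F t)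
    {T : ℝ} (hT : 0 ≤ T) (hg : IntegrableOn g (Ioi T))
    (h : ∀ᵐ t ∂volume.restrict (Ioi T), deriv F t ≤ g t) :
    ∃ l, Tendsto F atTop (𝓝 l) := by
  have hi : ∀ u v, T ≤ u → T ≤ v → IntervalIntegrable g volume u v := fun u v hu hv =>
    intervalIntegrable_iff.2 (hg.mono_set fun r hr => lt_of_le_of_lt (le_min hu hv) hr.1)
  have hlim := intervalIntegral_tendsto_integral_Ioi T hg tendsto_id
  -- Freezing the argument below `T` makes `A` monotone on the whole line.
  set A : ℝ → ℝ := fun t => F (max t T) - ∫ r in T..(max t T), g r with hA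
  have hanti : Antitone A := by
    intro s t hst
    have hst' : max s T ≤ max t T := max_le_max_right T hst
    have hs : T ≤ max s T := le_max_right _ _
    have h1 := (hF.absolutelyContinuousOnInterval (hT.trans hs) hst').sub_le_integral hst'
      (hi _ _ hs (hs.trans hst')) (ae_restrict_of_ae_restrict_of_subset
        (fun r hr => lt_of_le_of_lt hs hr.1) h)
    have h2 := intervalIntegral.integral_add_adjacent_intervals (hi T _ le_rfl hs)
      (hi _ _ hs (hs.trans hst'))
    simp only [hA]
    linarith
  have hbdd : BddBelow (range A) := by
    refine ⟨-∫ r in Ioi T, ‖g r‖, ?_⟩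
    rintro _ ⟨t, rfl⟩
    have h1 : ∫ r in T..(max t T), g r ≤ ∫ r in Ioi T, ‖g r‖ := by
      rw [intervalIntegral.integral_of_le (le_max_right _ _)]
      refine (Real.le_norm_self _).trans ((norm_integral_le_integral_norm _).trans ?_)
      exact setIntegral_mono_set hg.norm (ae_of_all _ fun _ => norm_nonneg _)
        Ioc_subset_Ioi_self.eventuallyLE
    have h2 := hF0 (max t T)
    simp only [hA]
    linarith
  refine ⟨_, ((tendsto_atTop_ciInf hanti hbdd).add hlim).congr' ?_⟩
  filter_upwards [eventually_ge_atTop T] with t ht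
  simp [hA, max_eq_left ht]

/-- Integrating the inequality would drive `F` to `-∞`. -/
theorem LocallyAC.not_ae_deriv_le_sub_const (hF : LocallyAC F) (hF0 : ∀ t, 0 ≤ F t)
    {T ε : ℝ} (hT : 0 ≤ T) (hε : 0 < ε) (hg : IntegrableOn g (Ioi T)) :
    ¬ ∀ᵐ t ∂volume.restrict (Ioi T), deriv F t ≤ g t - ε := by
  intro h
  have hi : ∀ t, T ≤ t → IntervalIntegrable g volume T t := fun t ht =>
    intervalIntegrable_iff.2 (hg.mono_set fun r hr => lt_of_le_of_lt (le_min le_rfl ht) hr.1)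
  have hlim := intervalIntegral_tendsto_integral_Ioi T hg tendsto_id
  have hdiv : Tendsto (fun t => F T + (∫ r in T..t, g r) + -(t - T) * ε) atTop atBot := by
    refine (tendsto_const_nhds.add hlim).add_atBot ?_
    refine Tendsto.atBot_mul_const hε (tendsto_neg_atTop_atBot.comp ?_)
    exact tendsto_atTop_add_const_right _ _ tendsto_id
  obtain ⟨t, ht, hTt⟩ := ((hdiv.eventually (eventually_lt_atBot 0)).and
    (eventually_ge_atTop T)).exists
  have h1 := (hF.absolutelyContinuousOnInterval hT hTt).sub_le_integral hTt
    ((hi t hTt).sub intervalIntegrable_const)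
    (ae_restrict_of_ae_restrict_of_subset Ioc_subset_Ioi_self h)
  rw [intervalIntegral.integral_sub (hi t hTt) intervalIntegrable_const,
    intervalIntegral.integral_const, smul_eq_mul] at h1
  have := hF0 t
  linarith

end DifferentialInequality

/-! ### The distance on the free vertices and its time derivative. -/

section FreeDist

variable {V : Type*} {D : Set V}

theorem sub_sub_sub_mem_constraintSet_zero {b c x z : EuclideanSpace ℝ V}
    (hx : x ∈ constraintSet D b) (hz : z ∈ constraintSet D c) :
    x - z - (b - c) ∈ constraintSet D (0 : EuclideanSpace ℝ V) := fun v hv => by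
  have h1 := hx v hv
  have h2 := hz v hv
  simp_all

theorem sub_sub_sub_apply_of_notMem {b c x z : EuclideanSpace ℝ V}
    (hb : ∀ v, v ∉ D → b v = 0) (hc : ∀ v, v ∉ D → c v = 0) (v : V) (hv : v ∉ D) :
    (x - z - (b - c)) v = (x - z) v := by
  simp [hb v hv, hc v hv]

variable [Fintype V]

/-- The square of the distance of the restrictions of `x` and `z` to the free vertices. -/
noncomputable def freeDistSq (D : Set V) (x z : EuclideanSpace ℝ V) : ℝ :=
  ∑ v ∈ (Set.toFinite Dᶜ).toFinset, (x v - z v) ^ 2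

theorem freeDistSq_nonneg (x z : EuclideanSpace ℝ V) : 0 ≤ freeDistSq D x z :=
  Finset.sum_nonneg fun _ _ => sq_nonneg _

theorem sum_free_eq_inner {y u d : EuclideanSpace ℝ V}
    (hd : d ∈ constraintSet D (0 : EuclideanSpace ℝ V)) (hu : ∀ v, v ∉ D → d v = u v) :
    ∑ v ∈ (Set.toFinite Dᶜ).toFinset, u v * y v = inner ℝ y d := by
  rw [PiLp.inner_apply]
  refine (Finset.sum_congr rfl fun v hv => ?_).trans
    (Finset.sum_subset (Finset.subset_univ _) fun v _ hv => ?_)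
  · rw [← hu v (by simpa using hv)]
    simp
  · have : v ∈ D := by simpa using hv
    simp [hd v this]

theorem freeDistSq_eq_norm_sq {b c x z : EuclideanSpace ℝ V}
    (hb : ∀ v, v ∉ D → b v = 0) (hc : ∀ v, v ∉ D → c v = 0)
    (hx : x ∈ constraintSet D b) (hz : z ∈ constraintSet D c) :
    freeDistSq D x z = ‖x - z - (b - c)‖ ^ 2 := by
  have hd := sub_sub_sub_mem_constraintSet_zero hx hz
  have hu : ∀ v, v ∉ D → (x - z - (b - c)) v = (x - z) v :=
    sub_sub_sub_apply_of_notMem hb hc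
  rw [← real_inner_self_eq_norm_sq, ← sum_free_eq_inner hd hu]
  refine Finset.sum_congr rfl fun v hv => ?_
  rw [hu v (by simpa using hv), sq, PiLp.sub_apply]

theorem LocallyAC.apply {x : ℝ → EuclideanSpace ℝ V} (hx : LocallyAC x) (v : V) :
    LocallyAC fun t => x t v := by
  intro T hT
  refine squeeze_zero (fun E => Finset.sum_nonneg fun _ _ => dist_nonneg)
    (fun E => Finset.sum_le_sum fun i _ => ?_) (hx T hT)
  rw [dist_eq_norm, dist_eq_norm, ← PiLp.sub_apply]
  exact PiLp.norm_apply_le _ v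

theorem LocallyAC.freeDistSq {x : ℝ → EuclideanSpace ℝ V} (hx : LocallyAC x)
    (z : EuclideanSpace ℝ V) : LocallyAC fun t => freeDistSq D (x t) z := by
  intro T hT
  unfold _root_.freeDistSq
  have hconst : ∀ c : ℝ, AbsolutelyContinuousOnInterval (fun _ => c) 0 T := fun c => by
    simpa [AbsolutelyContinuousOnInterval] using tendsto_const_nhds
  induction (Set.toFinite Dᶜ).toFinset using Finset.cons_induction with
  | empty => simpa using hconst 0
  | cons v s hv ih =>
    simp only [Finset.sum_cons]
    have h1 : AbsolutelyContinuousOnInterval (fun t => x t v - z v) 0 T :=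
      (hx.apply v T hT).sub (hconst (z v))
    have h2 := h1.fun_mul h1
    simp only [← sq] at h2
    exact h2.add ih

/-- Differentiability reduces to the scalar coordinates on the countably many intervals `[0, n +
1]`. -/
theorem LocallyAC.ae_differentiableAt {x : ℝ → EuclideanSpace ℝ V} (hx : LocallyAC x) :
    ∀ᵐ t ∂volume.restrict (Ioi (0 : ℝ)), DifferentiableAt ℝ x t := by
  rw [ae_restrict_iff' measurableSet_Ioi]
  have h : ∀ᵐ t : ℝ, ∀ n : ℕ, ∀ v : V, t ∈ uIcc 0 ((n : ℝ) + 1) →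
      DifferentiableAt ℝ (fun t => x t v) t := by
    refine ae_all_iff.2 fun n => ae_all_iff.2 fun v => ?_
    exact (hx.apply v (n + 1) (by positivity)).ae_differentiableAt
  filter_upwards [h] with t ht ht0
  obtain ⟨n, hn⟩ := exists_nat_ge t
  refine (differentiableAt_euclidean).2 fun v => ht n v ?_
  rw [uIcc_of_le (by positivity)]
  exact ⟨le_of_lt ht0, by linarith⟩

/-- Only free coordinates are differentiated, so with `b = a t` no derivative of `a` enters. -/
theorem deriv_freeDistSq {x : ℝ → EuclideanSpace ℝ V} {t : ℝ} (hx : DifferentiableAt ℝ x t)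
    {b c z : EuclideanSpace ℝ V} (hb : ∀ v, v ∉ D → b v = 0) (hc : ∀ v, v ∉ D → c v = 0)
    (hxb : x t ∈ constraintSet D b) (hz : z ∈ constraintSet D c) :
    deriv (fun t => freeDistSq D (x t) z) t =
      2 * inner ℝ (deriv x t) (x t - z - (b - c)) := by
  have hd := sub_sub_sub_mem_constraintSet_zero hxb hz
  have hu : ∀ v, v ∉ D → (x t - z - (b - c)) v = (x t - z) v :=
    sub_sub_sub_apply_of_notMem hb hc
  rw [← sum_free_eq_inner hd hu, Finset.mul_sum]
  refine HasDerivAt.deriv (HasDerivAt.fun_sum fun v _ => ?_)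
  have h1 : HasDerivAt (fun t => x t v) (deriv x t v) t :=
    ((EuclideanSpace.proj v : EuclideanSpace ℝ V →L[ℝ] ℝ).hasFDerivAt.comp_hasDerivAt t
      hx.hasDerivAt)
  refine ((h1.sub_const (z v)).fun_pow 2).congr_deriv ?_
  simp only [PiLp.sub_apply]
  norm_num
  ring

end FreeDist

/-! ### Boundedness and convergence of the solution. -/

section Convergence

variable {V : Type*} [Fintype V] {G : WeightedHypergraph V} {D : Set V} {p : ℝ}
  {a h x : ℝ → EuclideanSpace ℝ V} {a' h' x₀ z : EuclideanSpace ℝ V}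

namespace WeightedHypergraph

/-- The inclusion gives the constraint for almost every time; continuity of `x - a` and density of
sets of full measure give it for every `t > 0`. -/
theorem IsGlobalSolution.mem_constraintSet (hx : G.IsGlobalSolution p D a h x₀ x)
    (ha : LocallyAC a) {t : ℝ} (ht : 0 < t) : x t ∈ constraintSet D (a t) := by
  by_contra hne
  have hcont : ∀ s, 0 < s → ContinuousAt (fun s => x s - a s) s := fun s hs =>
    ((hx.memW12Loc.locallyAC.continuousOn.sub ha.continuousOn).continuousAt (Ici_mem_nhds hs))
  obtain ⟨v, hv, hvne⟩ : ∃ v ∈ D, x t v ≠ a t v := by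
    simpa [constraintSet] using hne
  have h1 : ∀ᶠ s in 𝓝 t, 0 < s ∧ (x s - a s) v ≠ 0 := by
    refine (lt_mem_nhds ht).and (ContinuousAt.eventually_ne (g := fun s => (x s - a s) v) ?_ ?_)
    · exact ((EuclideanSpace.proj v).continuous.continuousAt (x := x t - a t)).comp
        (f := fun s => x s - a s) (hcont t ht)
    · simpa [sub_eq_zero] using hvne
  have h2 : ∀ᵐ s ∂volume.restrict (Ioi (0 : ℝ)), x s ∈ constraintSet D (a s) := by
    filter_upwards [hx.inclusion] with s hs
    obtain ⟨_, _, q, hq, _⟩ := Set.mem_add.1 hs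
    exact (mem_constrainedLaplacian_iff.1 hq).1
  rw [ae_restrict_iff' measurableSet_Ioi] at h2
  obtain ⟨s, hs2, hs0, hs1⟩ :=
    ((mem_closure_iff_frequently.1 (Measure.dense_of_ae h2 t)).and_eventually h1).exists
  exact hs1 (by simp [hs2 hs0 v hv])

/-- The differential inequality for the distance to an equilibrium, with an integrable right-hand
side, and the eventual boundedness of the solution. -/
theorem IsGlobalSolution.exists_deriv_freeDistSq_le (hx : G.IsGlobalSolution p D a h x₀ x)
    (hp1 : 1 ≤ p) (hp3 : p ≤ 3)
    (ha_free : ∀ t, 0 ≤ t → ∀ v, v ∉ D → a t v = 0) (ha'_free : ∀ v, v ∉ D → a' v = 0)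
    (ha : LocallyAC a) (ha_lim : Tendsto a atTop (𝓝 a'))
    (ha_L1 : IntegrableOn (fun t => a t - a') (Ioi 0))
    (hh_L1 : IntegrableOn (fun t => h t - h') (Ioi 0))
    (hz : h' ∈ G.constrainedLaplacian p D a' z) :
    ∃ (T M : ℝ) (g : ℝ → ℝ), 0 ≤ T ∧ IntegrableOn g (Ioi T) ∧ (∀ t, T ≤ t → ‖x t‖ ≤ M) ∧
      ∀ᵐ t ∂volume.restrict (Ioi T),
        deriv (fun t => freeDistSq D (x t) z) t ≤ g t ∧
        deriv (fun t => freeDistSq D (x t) z) t ≤ g t - 2 *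
          (G.energy p (x t) - G.energy p z - inner ℝ h' (x t - z - (a t - a'))) := by
  obtain ⟨C, hC, hgrow⟩ := G.exists_subgradient_norm_le hp1 hp3
  obtain ⟨hzK, ζ, hζ, hζ'⟩ := mem_constrainedLaplacian_iff.1 hz
  have hxAC := hx.memW12Loc.locallyAC
  obtain ⟨S, hS⟩ : ∃ S, ∀ t, S ≤ t → ‖a t - a'‖ ≤ 1 := by
    have := (tendsto_iff_norm_sub_tendsto_zero.1 ha_lim).eventually (gt_mem_nhds one_pos)
    obtain ⟨S, hS⟩ := eventually_atTop.1 this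
    exact ⟨S, fun t ht => (hS t ht).le⟩
  have hdist : ∀ t, 0 < t → freeDistSq D (x t) z = ‖x t - z - (a t - a')‖ ^ 2 := fun t ht =>
    freeDistSq_eq_norm_sq (ha_free t ht.le) ha'_free (hx.mem_constraintSet ha ht) hzK
  have hnorm : ∀ t, S ≤ t → ‖x t‖ ≤ ‖x t - z - (a t - a')‖ + ‖z‖ + 1 := fun t ht => by
    have h1 : x t = (x t - z - (a t - a')) + z + (a t - a') := by abel
    calc ‖x t‖ = ‖(x t - z - (a t - a')) + z + (a t - a')‖ := by rw [← h1]
      _ ≤ _ := norm_add₃_le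
      _ ≤ _ := by gcongr; exact hS t ht
  have hpt : ∀ᵐ t ∂volume.restrict (Ioi (0 : ℝ)),
      ∃ η : EuclideanSpace ℝ V, ‖η‖ ≤ C * (1 + ‖x t‖) ^ 2 ∧
      deriv (fun t => freeDistSq D (x t) z) t ≤
        2 * (‖h t - h'‖ * ‖x t - z - (a t - a')‖ + ‖a t - a'‖ * ‖η‖) - 2 *
        (G.energy p (x t) - G.energy p z - inner ℝ h' (x t - z - (a t - a'))) ∧
      -(‖ζ‖ * ‖a t - a'‖) ≤
        G.energy p (x t) - G.energy p z - inner ℝ h' (x t - z - (a t - a')) := by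
    filter_upwards [hx.inclusion, hxAC.ae_differentiableAt, ae_restrict_mem measurableSet_Ioi]
      with t hincl hdiff ht
    obtain ⟨η, hη, h1, h2⟩ := G.inner_velocity_le hzK hζ hζ' hincl
    refine ⟨η, hgrow _ _ hη, ?_, h2⟩
    rw [deriv_freeDistSq hdiff (ha_free t (le_of_lt ht)) ha'_free
      (hx.mem_constraintSet ha ht) hzK]
    linarith
  have hha := ha_L1.norm
  have hhh := hh_L1.norm
  -- Chosen so that `‖η‖ ≤ B (1 + r²)` with `r = ‖x t - z - (a t - a')‖`, using `‖x t‖ ≤ r + ‖z‖ +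
  -- 1`.
  set B := C * (2 * (‖z‖ + 2) ^ 2) with hB
  have hB0 : 0 ≤ B := by positivity
  obtain ⟨T, M, hST, hT0, hM⟩ : ∃ T M, max S 0 ≤ T ∧ 0 ≤ T ∧
      ∀ t, T ≤ t → freeDistSq D (x t) z ≤ M := by
    refine (hxAC.freeDistSq z).exists_bound_of_deriv_le
      (k := fun t => 2 * (‖h t - h'‖ + B * ‖a t - a'‖ + ‖ζ‖ * ‖a t - a'‖))
      (fun t => freeDistSq_nonneg _ _)
      (((hhh.add (hha.const_mul B)).add (hha.const_mul ‖ζ‖)).const_mul 2)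
      (fun t => by positivity) ?_
    filter_upwards [ae_restrict_of_ae_restrict_of_subset
      (Ioi_subset_Ioi (le_max_right S 0)) hpt, ae_restrict_mem measurableSet_Ioi] with t ht htm
    obtain ⟨η, h1, h2, h3⟩ := ht
    have htS : S ≤ t := (le_max_left _ _).trans (le_of_lt htm)
    have ht0 : 0 < t := lt_of_le_of_lt (le_max_right _ _) htm
    rw [hdist t ht0]
    set r := ‖x t - z - (a t - a')‖ with hr
    have hr0 : 0 ≤ r := norm_nonneg _
    have hη : ‖η‖ ≤ B * (1 + r ^ 2) := by
      refine h1.trans ?_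
      rw [hB, mul_assoc C]
      refine mul_le_mul_of_nonneg_left ?_ hC
      have h4 : 1 + ‖x t‖ ≤ (‖z‖ + 2) * (1 + r) := by
        have := hnorm t htS
        have := mul_nonneg (norm_nonneg z) hr0
        nlinarith
      calc (1 + ‖x t‖) ^ 2 ≤ ((‖z‖ + 2) * (1 + r)) ^ 2 := by gcongr
        _ = (‖z‖ + 2) ^ 2 * (1 + r) ^ 2 := by ring
        _ ≤ (‖z‖ + 2) ^ 2 * (2 * (1 + r ^ 2)) := by
          gcongr; nlinarith [sq_nonneg (1 - r)]
        _ = _ := by ring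
    have h5 := mul_le_mul_of_nonneg_left hη (norm_nonneg (a t - a'))
    have h6 : ‖h t - h'‖ * r ≤ ‖h t - h'‖ * (1 + r ^ 2) :=
      mul_le_mul_of_nonneg_left (by nlinarith [sq_nonneg (1 - r)]) (norm_nonneg _)
    have h7 : ‖ζ‖ * ‖a t - a'‖ ≤ ‖ζ‖ * ‖a t - a'‖ * (1 + r ^ 2) :=
      le_mul_of_one_le_right (by positivity) (by nlinarith)
    linarith
  have hM' : ∀ t, T < t → ‖x t - z - (a t - a')‖ ≤ √M := fun t ht => by
    refine Real.le_sqrt_of_sq_le ?_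
    rw [← hdist t (hT0.trans_lt ht)]
    exact hM t ht.le
  set N := √M + ‖z‖ + 1 with hN
  have hxN : ∀ t, T < t → ‖x t‖ ≤ N := fun t ht => by
    have h1 := hnorm t ((le_max_left S 0).trans (hST.trans ht.le))
    have h2 := hM' t ht
    linarith
  -- The `ζ` term compensates a possibly negative excess, so one `g` serves both inequalities. The
  -- shift to `T + 1` turns bounds valid for `t > T` into bounds on a closed half-line.
  refine ⟨T + 1, N, fun t => 2 * (‖h t - h'‖ * √M + ‖a t - a'‖ * (C * (1 + N) ^ 2) +
    ‖ζ‖ * ‖a t - a'‖), by linarith, ?_, fun t ht => hxN t (by linarith), ?_⟩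
  · refine IntegrableOn.mono_set (t := Ioi 0) ?_ (Ioi_subset_Ioi (by linarith))
    exact (((hhh.mul_const _).add (hha.mul_const _)).add (hha.const_mul ‖ζ‖)).const_mul 2
  · filter_upwards [ae_restrict_of_ae_restrict_of_subset
      (Ioi_subset_Ioi (show 0 ≤ T + 1 by linarith)) hpt, ae_restrict_mem measurableSet_Ioi]
      with t ht htm
    obtain ⟨η, h1, h2, h3⟩ := ht
    have htT : T < t := by linarith [mem_Ioi.1 htm]
    have h4 : ‖η‖ ≤ C * (1 + N) ^ 2 := h1.trans (by gcongr; exact hxN t htT)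
    have h5 := mul_le_mul_of_nonneg_left h4 (norm_nonneg (a t - a'))
    have h6 := mul_le_mul_of_nonneg_left (hM' t htT) (norm_nonneg (h t - h'))
    have h7 : 0 ≤ ‖ζ‖ * ‖a t - a'‖ := by positivity
    constructor <;> linarith

end WeightedHypergraph

end Convergence

theorem theorem5p4 {V : Type*} [Fintype V] (G : WeightedHypergraph V) (D : Set V)
    (p : ℝ) (hp1 : 1 ≤ p) (hp3 : p < 3)
    (a h x : ℝ → EuclideanSpace ℝ V) (a_inf h_inf x₀ : EuclideanSpace ℝ V)
    -- `a(t)` vanishes on the free vertices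
    (ha_free : ∀ t, 0 ≤ t → ∀ v, v ∉ D → a t v = 0)
    -- `a ∈ W^{1,2}_loc`, `a' ∈ L^1 ∩ L^2`, `a(t) → a_∞`, `a - a_∞ ∈ L^1`
    (ha : MemW12Loc a)
    (ha'_L1 : MemLp (deriv a) 1 (volume.restrict (Ioi 0)))
    (ha'_L2 : MemLp (deriv a) 2 (volume.restrict (Ioi 0)))
    (ha_lim : Tendsto a atTop (𝓝 a_inf))
    (ha_L1 : MemLp (fun t => a t - a_inf) 1 (volume.restrict (Ioi 0)))
    -- `h ∈ L^2_loc`, `h' ∈ L^1`, `h(t) → h_∞`, `h - h_∞ ∈ L^1 ∩ L^2`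
    (hh : MemL2Loc h) (hh_ac : LocallyAC h)
    (hh'_L1 : MemLp (deriv h) 1 (volume.restrict (Ioi 0)))
    (hh_lim : Tendsto h atTop (𝓝 h_inf))
    (hh_L1 : MemLp (fun t => h t - h_inf) 1 (volume.restrict (Ioi 0)))
    (hh_L2 : MemLp (fun t => h t - h_inf) 2 (volume.restrict (Ioi 0)))
    -- `h_∞` lies in the range of `∂φ + ∂I_{K_{a_∞}}`
    (h_range : ∃ z, h_inf ∈ G.constrainedLaplacian p D a_inf z)
    -- `x` is the solution with initial value `x₀ ∈ K_{a(0)}`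
    (hx₀ : x₀ ∈ constraintSet D (a 0))
    (hx : G.IsGlobalSolution p D a h x₀ x) :
    ∃ x_inf : EuclideanSpace ℝ V,
      Tendsto x atTop (𝓝 x_inf) ∧
      (∀ y, Tendsto x atTop (𝓝 y) → y = x_inf) ∧
      h_inf ∈ G.constrainedLaplacian p D a_inf x_inf := by
  have hxAC := hx.memW12Loc.locallyAC
  have hmem : ∀ t, 0 < t → x t ∈ constraintSet D (a t) := fun t ht =>
    hx.mem_constraintSet ha.locallyAC ht
  have happly : ∀ v, Tendsto (fun t => a t v) atTop (𝓝 (a_inf v)) := fun v =>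
    ((EuclideanSpace.proj v).continuous.tendsto a_inf).comp ha_lim
  have ha_inf_free : ∀ v, v ∉ D → a_inf v = 0 := fun v hv =>
    tendsto_nhds_unique_of_eventuallyEq (happly v) tendsto_const_nhds
      ((eventually_ge_atTop 0).mono fun t ht => ha_free t ht v hv)
  have key := fun {z} => hx.exists_deriv_freeDistSq_le (z := z) hp1 hp3.le ha_free ha_inf_free
    ha.locallyAC ha_lim (memLp_one_iff_integrable.1 ha_L1) (memLp_one_iff_integrable.1 hh_L1)
  obtain ⟨z, hz⟩ := h_range
  obtain ⟨T, M, g, hT0, hg, hM, hderiv⟩ := key hz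
  -- times along which the excess of the tilted energy tends to its infimum
  have hseq : ∀ n : ℕ, ∃ t, T + n < t ∧
      G.energy p (x t) - G.energy p z - inner ℝ h_inf (x t - z - (a t - a_inf)) <
        1 / ((n : ℝ) + 1) := by
    intro n
    by_contra! hcon
    have hTn : T ≤ T + n := by simp
    refine (hxAC.freeDistSq (D := D) z).not_ae_deriv_le_sub_const
      (ε := 2 * (1 / ((n : ℝ) + 1)))
      (fun t => freeDistSq_nonneg _ _) (hT0.trans hTn) (by positivity)
      (hg.mono_set (Ioi_subset_Ioi hTn)) ?_
    filter_upwards [ae_restrict_of_ae_restrict_of_subset (Ioi_subset_Ioi hTn) hderiv,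
      ae_restrict_mem measurableSet_Ioi] with t ht htm
    have := hcon t htm
    linarith [ht.2]
  choose τ hτ hτ' using hseq
  obtain ⟨y, -, σ, hσ, hy⟩ := tendsto_subseq_of_bounded
    (Metric.isBounded_closedBall (x := (0 : EuclideanSpace ℝ V)) (r := M))
    (x := fun n => x (τ n)) fun n => by
      simpa using hM (τ n) (by have := hτ n; have : (0 : ℝ) ≤ n := by positivity
                               linarith)
  have hτσ : Tendsto (fun n => τ (σ n)) atTop atTop := by
    refine Tendsto.comp (tendsto_atTop_mono (fun n => ?_) tendsto_natCast_atTop_atTop)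
      hσ.tendsto_atTop
    linarith [hτ n]
  have hτpos : ∀ n, 0 < τ n := fun n => by
    have := hτ n
    have : (0 : ℝ) ≤ n := by positivity
    linarith
  have haτ := ha_lim.comp hτσ
  have hyK : y ∈ constraintSet D a_inf := fun v hv => by
    have h1 : Tendsto (fun n => x (τ (σ n)) v) atTop (𝓝 (y v)) :=
      ((EuclideanSpace.proj v).continuous.tendsto y).comp hy
    exact tendsto_nhds_unique_of_eventuallyEq h1 ((happly v).comp hτσ)
      (Eventually.of_forall fun n => hmem _ (hτpos _) v hv)
  have hy_eq : h_inf ∈ G.constrainedLaplacian p D a_inf y := by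
    refine G.mem_constrainedLaplacian_of_le hz hyK ?_
    have h1 : Tendsto (fun n => G.energy p (x (τ (σ n))) - G.energy p z -
        inner ℝ h_inf (x (τ (σ n)) - z - (a (τ (σ n)) - a_inf))) atTop
        (𝓝 (G.energy p y - G.energy p z - inner ℝ h_inf (y - z - (a_inf - a_inf)))) := by
      refine ((((G.continuous_energy hp1).tendsto y).comp hy).sub_const _).sub ?_
      exact tendsto_const_nhds.inner ((hy.sub_const z).sub (haτ.sub_const a_inf))
    rw [sub_self, sub_zero] at h1
    exact le_of_tendsto_of_tendsto' h1
      (tendsto_one_div_add_atTop_nhds_zero_nat.comp hσ.tendsto_atTop) fun n => (hτ' _).le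
  -- The estimate is used again, now centred at the cluster point `y`.
  obtain ⟨S, _, g', hS0, hg', -, hderiv'⟩ := key hy_eq
  obtain ⟨l, hl⟩ := (hxAC.freeDistSq (D := D) y).exists_tendsto_of_deriv_le
    (fun t => freeDistSq_nonneg _ _) hS0 hg' (hderiv'.mono fun t ht => ht.1)
  have hsq : Tendsto (fun t => ‖x t - y - (a t - a_inf)‖ ^ 2) atTop (𝓝 l) := by
    refine hl.congr' ?_
    filter_upwards [eventually_gt_atTop 0] with t ht
    exact freeDistSq_eq_norm_sq (ha_free t ht.le) ha_inf_free (hmem t ht) hyK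
  -- The limit over all times exists, so it may be computed along `τ ∘ σ`.
  have hl0 : l = 0 := by
    refine tendsto_nhds_unique (hsq.comp hτσ) ?_
    have := (((hy.sub_const y).sub (haτ.sub_const a_inf)).norm).pow 2
    simpa [Function.comp_def] using this
  have hlim : Tendsto x atTop (𝓝 y) := by
    rw [hl0] at hsq
    have h1 : Tendsto (fun t => x t - y - (a t - a_inf)) atTop (𝓝 0) := by
      rw [tendsto_zero_iff_norm_tendsto_zero]
      simpa using hsq.sqrt
    have h2 := (h1.add (ha_lim.sub_const a_inf)).add_const y
    simpa using h2
  exact ⟨y, hlim, fun y' hy' => tendsto_nhds_unique hy' hlim, hy_eq⟩
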